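/- Let $\mathfrak g$ be a finite-dimensional complex Lie algebra of the form $\mathfrak g=\mathfrak g_0\ltimes\mathfrak p$, that is, $\mathfrak g_0$ is a Lie subalgebra of $\mathfrak g$, $\mathfrak p$ is an ideal of $\mathfrak g$, and $\mathfrak g=\mathfrak g_0\oplus\mathfrak p$ as vector spaces. Let $\phi:\mathfrak p\to\mathbb C$ be a Lie algebra homomorphism (where $\mathbb C$ is the abelian one-dimensional Lie algebra), let $\mathbb C w_\phi$ be the one-dimensional $\mathfrak p$-module on which each $p\in\mathfrak p$ acts by $p\,w_\phi=\phi(p)w_\phi$, and let $$W(\phi)=\mathrm{Ind}_{\mathfrak p}^{\mathfrak g}\,\mathbb C w_\phi=\mathcal U(\mathfrak g)\otimes_{\mathcal U(\mathfrak p)}\mathbb C w_\phi$$ be the induced $\mathfrak g$-module. Let $g_1,\dots,g_t$ be a basis of $\mathfrak g_0$ and $p_1,\dots,p_\ell$ a basis of $\mathfrak p$, and let $A_\phi$ be the $\ell\times t$ complex matrix whose entry in row $i$ and column $j$ is $\phi([g_j,p_i])$. Then $W(\phi)$ is an irreducible $\mathfrak g$-module if and only if $\operatorname{rank}A_\phi=t$.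 -/

import Mathlib

open scoped TensorProduct

noncomputable section

namespace QuasiWhittaker

universe u v w

/- Associative algebras are Lie algebras under the commutator. -/
attribute [local instance 100] LieRing.ofAssociativeRing

section Induced

variable (R : Type u) {L : Type v} [CommRing R] [LieRing L] [LieAlgebra R L]
variable (p : LieIdeal R L)
variable (M : Type w) [AddCommGroup M] [Module R M] [LieRingModule p M] [LieModule R p M]

/-- The algebra map `U(p) → U(L)` induced by the inclusion of the ideal `p` in `L`. -/
def envelopingIncl :
    UniversalEnvelopingAlgebra R p →ₐ[R] UniversalEnvelopingAlgebra R L :=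
  UniversalEnvelopingAlgebra.lift R
    ((UniversalEnvelopingAlgebra.ι R : L →ₗ⁅R⁆ UniversalEnvelopingAlgebra R L).comp p.incl)

/-- The action of `U(p)` on a `p`-module `M`. -/
def envelopingAction : UniversalEnvelopingAlgebra R p →ₐ[R] Module.End R M :=
  UniversalEnvelopingAlgebra.lift R (LieModule.toEnd R p M)

/-- The relations `(u a) ⊗ m = u ⊗ (a m)`, for `u ∈ U(L)`, `a ∈ U(p)`, `m ∈ M`, which cut
`U(L) ⊗_{U(p)} M` out of `U(L) ⊗_R M`. -/
def indRelations :
    Submodule (UniversalEnvelopingAlgebra R L) (UniversalEnvelopingAlgebra R L ⊗[R] M) :=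
  Submodule.span (UniversalEnvelopingAlgebra R L)
    {z | ∃ (u : UniversalEnvelopingAlgebra R L) (a : UniversalEnvelopingAlgebra R p) (m : M),
      z = (u * envelopingIncl R p a) ⊗ₜ[R] m - u ⊗ₜ[R] (envelopingAction R p M a m)}

/-- The induced module `Ind_p^L M = U(L) ⊗_{U(p)} M`. -/
abbrev Ind : Type (max v u w) :=
  (UniversalEnvelopingAlgebra R L ⊗[R] M) ⧸ indRelations R p M

/-- `L` acts on the induced module through `L → U(L)`. -/
instance : LieRingModule L (Ind R p M) where
  bracket x z := UniversalEnvelopingAlgebra.ι R x • z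
  add_lie x y z := by
    change UniversalEnvelopingAlgebra.ι R (x + y) • z = _
    rw [map_add, add_smul]
  lie_add x y z := smul_add _ y z
  leibniz_lie x y z := by
    change UniversalEnvelopingAlgebra.ι R x • UniversalEnvelopingAlgebra.ι R y • z =
      UniversalEnvelopingAlgebra.ι R ⁅x, y⁆ • z +
        UniversalEnvelopingAlgebra.ι R y • UniversalEnvelopingAlgebra.ι R x • z
    rw [LieHom.map_lie, LieRing.of_associative_ring_bracket, sub_smul, mul_smul, mul_smul,
      sub_add_cancel]

instance : LieModule R L (Ind R p M) where
  smul_lie r x z := by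
    change UniversalEnvelopingAlgebra.ι R (r • x) • z = r • (UniversalEnvelopingAlgebra.ι R x • z)
    rw [map_smul, smul_assoc]
  lie_smul r x z := smul_comm (UniversalEnvelopingAlgebra.ι R x) r z

end Induced

section Whittaker

variable {R : Type u} {L : Type v} [CommRing R] [LieRing L] [LieAlgebra R L]
variable {p : LieIdeal R L}

/-- The rank one `p`-module `R w_φ` attached to a Lie algebra homomorphism `φ : p → R`:
the underlying module is `R`, and `x ∈ p` acts as multiplication by `φ x`. -/
def RankOne (_φ : LieAlgebra.LieCharacter R p) : Type u := R

instance (φ : LieAlgebra.LieCharacter R p) : AddCommGroup (RankOne φ) :=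
  inferInstanceAs (AddCommGroup R)

instance (φ : LieAlgebra.LieCharacter R p) : Module R (RankOne φ) :=
  inferInstanceAs (Module R R)

instance (φ : LieAlgebra.LieCharacter R p) : LieRingModule p (RankOne φ) where
  bracket x c := φ x • c
  add_lie x y c := by
    change φ (x + y) • c = φ x • c + φ y • c
    rw [map_add, add_smul]
  lie_add x c d := smul_add (φ x) c d
  leibniz_lie x y c := by
    change φ x • φ y • c = φ ⁅x, y⁆ • c + φ y • φ x • c
    rw [LieAlgebra.lieCharacter_apply_lie, zero_smul, zero_add, smul_comm]

instance (φ : LieAlgebra.LieCharacter R p) : LieModule R p (RankOne φ) where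
  smul_lie r x c := by
    change φ (r • x) • c = r • φ x • c
    rw [map_smul, smul_assoc]
  lie_smul r x c := smul_comm (φ x) r c

/-- The universal quasi-Whittaker module `W(φ) = Ind_p^L (R w_φ)` of type `φ`. -/
abbrev W (φ : LieAlgebra.LieCharacter R p) : Type (max u v) := Ind R p (RankOne φ)

/-- The matrix `A_φ` with rows indexed by a basis of `p`, columns by a basis of the subalgebra `g₀`,
and entry `φ([g_j, p_i])` in row `i` and column `j`. The bracket is taken in `L`; it lies in the
ideal `p`. -/
def bracketMatrix {m n : Type*} {g₀ : LieSubalgebra R L} (φ : LieAlgebra.LieCharacter R p)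
    (b : Module.Basis n R g₀) (c : Module.Basis m R p) : Matrix m n R :=
  Matrix.of fun i j =>
    φ ⟨⁅(b j : L), (c i : L)⁆, lie_mem_right R L p (b j : L) (c i : L) (c i).2⟩

end Whittaker

end QuasiWhittaker

end

/-! Let `w` be the generator of `W φ`. Full column rank means that `x ↦ φ ∘ ad x` is injective from
`g₀` to the dual of `p` (`rank_bracketMatrix_eq_iff`).

If it is injective, some `q i` in `p` satisfy `φ ⁅b j, q i⁆ = δ_ij`. Filter `W φ` by the length of
words in the `b j` applied to `w`. Modulo lower terms `q i - φ (q i)` acts as `-∂/∂b_i`, so `∑ b i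
(q i - φ (q i))` acts as `-n` in degree `n` (`euler_mem_filt`). A nonzero vector of least degree in
a submodule is killed by every `q i - φ (q i)`. In characteristic zero its degree is therefore 0,
and it is a multiple of `w`, which generates everything (`isIrreducible_of_dual_family`).

If instead `x ≠ 0` in `g₀` and `φ` vanishes on `⁅x, p⁆`, then `x w` lies in a proper submodule and
is nonzero. Both facts are detected by equivariant maps from `W φ` to functionals on polynomials
with values in a `g₀`-module `S`: they send `w` to `δ_v : f ↦ f(φ) v` and `x w` to `δ_{xv}`
(`exists_hom_delta`, `dualRep_delta_sub`). With `S` trivial, `x w` dies and `w` survives. With `S`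
the symmetric algebra of `g₀` under the Poincaré–Birkhoff–Witt action, `x · 1 = x`, so `x w`
survives too. Only this action of `g₀` is needed, not a basis of `W φ`. -/

noncomputable section

/-! ### The Poincaré–Birkhoff–Witt action of a Lie algebra on its symmetric algebra. -/

namespace PoincareBirkhoffWitt

open Module

attribute [local instance 100] LieRing.ofAssociativeRing

variable {ι R L : Type*} [CommRing R] [LieRing L] [LieAlgebra R L]

/-- The monomial in the symmetric algebra attached to a multiset of basis indices. -/
def mon (R : Type*) [CommRing R] {ι : Type*} (M : Multiset ι) : Multiset ι →₀ R :=
  Finsupp.single M 1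

/-- Elements of degree less than `n` in the symmetric algebra. -/
def degLT (R ι : Type*) [CommRing R] (n : ℕ) : Submodule R (Multiset ι →₀ R) :=
  Submodule.span R (mon R '' {M | M.card < n})

lemma mon_mem {M : Multiset ι} {n : ℕ} (h : M.card < n) : mon R M ∈ degLT R ι n :=
  Submodule.subset_span ⟨M, h, rfl⟩

lemma degLT_mono {m n : ℕ} (h : m ≤ n) : degLT R ι m ≤ degLT R ι n :=
  Submodule.span_mono (Set.image_mono fun _ hM => lt_of_lt_of_le hM h)

lemma degLT_induction {n : ℕ} {V : Type*} [AddCommGroup V] [Module R V]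
    (P : Submodule R V) (f : (Multiset ι →₀ R) →ₗ[R] V)
    (h : ∀ M : Multiset ι, M.card < n → f (mon R M) ∈ P) {s} (hs : s ∈ degLT R ι n) :
    f s ∈ P := by
  have : degLT R ι n ≤ P.comap f := by
    rw [degLT, Submodule.span_le]
    rintro _ ⟨M, hM, rfl⟩
    exact h M hM
  exact this hs

lemma basis_induction (e : Basis ι R L) {V : Type*} [AddCommGroup V] [Module R V]
    (P : Submodule R V) (f : L →ₗ[R] V) (h : ∀ i, f (e i) ∈ P) (x : L) : f x ∈ P := by
  have : (⊤ : Submodule R L) ≤ P.comap f := by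
    rw [← e.span_eq, Submodule.span_le]
    rintro _ ⟨i, rfl⟩
    exact h i
  exact this trivial

/-- `A` is multiplication to leading order in degrees below `n`. -/
def LeadingMul (e : Basis ι R L) (A : L →ₗ[R] Module.End R (Multiset ι →₀ R)) (n : ℕ) : Prop :=
  ∀ i, ∀ M : Multiset ι, M.card < n →
    A (e i) (mon R M) - mon R (i ::ₘ M) ∈ degLT R ι (M.card + 1)

lemma LeadingMul.apply_mem {e : Basis ι R L} {A : L →ₗ[R] Module.End R (Multiset ι →₀ R)}
    {n : ℕ} (hA : LeadingMul e A n) {m : ℕ} (hm : m ≤ n) (x : L) {s}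
    (hs : s ∈ degLT R ι m) : A x s ∈ degLT R ι (m + 1) := by
  refine degLT_induction _ (A x) (fun M hM => ?_) hs
  refine basis_induction e _ (A.flip (mon R M)) (fun i => ?_) x
  have h1 := degLT_mono (n := m + 1) (by omega) (hA i M (hM.trans_le hm))
  have h2 : mon R (i ::ₘ M) ∈ degLT R ι (m + 1) := mon_mem (by simpa using hM)
  simpa using add_mem h1 h2

variable [LinearOrder ι]

/-- `j` is a least element of the multiset `j ::ₘ N`, and `N` is the rest. -/
def IsMinSplit (M : Multiset ι) (j : ι) (N : Multiset ι) : Prop :=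
  M = j ::ₘ N ∧ ∀ k ∈ N, j ≤ k

lemma exists_isMinSplit {M : Multiset ι} (hM : M ≠ 0) : ∃ j N, IsMinSplit M j N := by
  have hne : M.toFinset.Nonempty := by
    obtain ⟨a, ha⟩ := Multiset.exists_mem_of_ne_zero hM
    exact ⟨a, by simpa using ha⟩
  have hmem : M.toFinset.min' hne ∈ M := by simpa using M.toFinset.min'_mem hne
  refine ⟨M.toFinset.min' hne, M.erase (M.toFinset.min' hne), (Multiset.cons_erase hmem).symm, ?_⟩
  intro k hk
  exact M.toFinset.min'_le k (by simpa using Multiset.mem_of_mem_erase hk)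

lemma IsMinSplit.unique {M N N' : Multiset ι} {j j' : ι} (h : IsMinSplit M j N)
    (h' : IsMinSplit M j' N') : j = j' ∧ N = N' := by
  obtain ⟨rfl, h1⟩ := h
  obtain ⟨h2, h3⟩ := h'
  have hj : j = j' := by
    have a1 : j ∈ j' ::ₘ N' := h2 ▸ Multiset.mem_cons_self j N
    have a2 : j' ∈ j ::ₘ N := h2 ▸ Multiset.mem_cons_self j' N'
    rcases Multiset.mem_cons.1 a1 with h | h
    · exact h
    rcases Multiset.mem_cons.1 a2 with h' | h'
    · exact h'.symm
    exact le_antisymm (h1 _ h') (h3 _ h)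
  subst hj
  exact ⟨rfl, (Multiset.cons_inj_right j).1 h2⟩

open Classical in
/-- The action of a basis vector on a monomial, given the action `A` in lower degree. -/
def step (e : Basis ι R L) (A : L →ₗ[R] Module.End R (Multiset ι →₀ R)) (i : ι)
    (M : Multiset ι) : Multiset ι →₀ R :=
  if h : ∃ q : ι × Multiset ι, IsMinSplit M q.1 q.2 ∧ q.1 < i then
    -- With `M = j ::ₘ N` and `j < i`, this is forced by `e_i e_j = e_j e_i + ⁅e_i, e_j⁆` on the
    -- monomial of `N`. The leading term of `e_i` on `N` is split off because `e_j` just multiplies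
    -- it, `j` being minimal; what remains has degree low enough for `A`.
    mon R (i ::ₘ M)
      + A (e h.choose.1) (A (e i) (mon R h.choose.2) - mon R (i ::ₘ h.choose.2))
      + A ⁅e i, e h.choose.1⁆ (mon R h.choose.2)
  else mon R (i ::ₘ M)

lemma step_of_lt (e : Basis ι R L) (A : L →ₗ[R] Module.End R (Multiset ι →₀ R)) {i j : ι}
    {M N : Multiset ι} (h : IsMinSplit M j N) (hj : j < i) :
    step e A i M = mon R (i ::ₘ M) + A (e j) (A (e i) (mon R N) - mon R (i ::ₘ N))
      + A ⁅e i, e j⁆ (mon R N) := by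
  have hex : ∃ q : ι × Multiset ι, IsMinSplit M q.1 q.2 ∧ q.1 < i := ⟨(j, N), h, hj⟩
  obtain ⟨h1, h2⟩ := hex.choose_spec.1.unique h
  rw [step, dif_pos hex, h1, h2]

lemma step_of_le (e : Basis ι R L) (A : L →ₗ[R] Module.End R (Multiset ι →₀ R)) {i : ι}
    {M : Multiset ι} (h : ∀ k ∈ M, i ≤ k) : step e A i M = mon R (i ::ₘ M) := by
  rw [step, dif_neg]
  rintro ⟨⟨j, N⟩, ⟨rfl, -⟩, hj⟩
  exact absurd (h j (Multiset.mem_cons_self j N)) (not_le.2 hj)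

/-- Successive approximations of the action of `L` on the symmetric algebra; the `n`-th one is
correct in degrees below `n`. -/
def approx (e : Basis ι R L) : ℕ → L →ₗ[R] Module.End R (Multiset ι →₀ R)
  | 0 => 0
  | n + 1 => e.constr R fun i => Finsupp.linearCombination R (step e (approx e n) i)

lemma approx_succ_mon (e : Basis ι R L) (n : ℕ) (i : ι) (M : Multiset ι) :
    approx e (n + 1) (e i) (mon R M) = step e (approx e n) i M := by
  simp [approx, mon]

lemma leadingMul_approx (e : Basis ι R L) (n : ℕ) : LeadingMul e (approx e n) n := by
  induction n with
  | zero => intro i M hM; omega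
  | succ n ih =>
    intro i M hM
    rw [approx_succ_mon]
    by_cases hle : ∀ k ∈ M, i ≤ k
    · rw [step_of_le e _ hle, sub_self]
      exact zero_mem _
    · push Not at hle
      obtain ⟨k, hk, hki⟩ := hle
      obtain ⟨j, N, hs⟩ := exists_isMinSplit (M := M) (by rintro rfl; simp at hk)
      have hj : j < i := by
        rcases Multiset.mem_cons.1 (hs.1 ▸ hk) with rfl | h
        · exact hki
        · exact (hs.2 k h).trans_lt hki
      have hc : M.card = N.card + 1 := by rw [hs.1]; simp
      rw [step_of_lt e _ hs hj, hc]
      have h1 := ih.apply_mem (m := N.card + 1) (by omega) (e j) (ih i N (by omega))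
      have h2 := ih.apply_mem (m := N.card + 1) (by omega) ⁅e i, e j⁆
        (mon_mem (R := R) (M := N) (by omega))
      convert add_mem h1 h2 using 1
      abel

/-- The recursion for a monomial calls the previous approximation only in strictly smaller degree,
so the approximations stabilise and can be glued into `act`. -/
lemma approx_succ_apply (e : Basis ι R L) (n : ℕ) (x : L) {s} (hs : s ∈ degLT R ι n) :
    approx e (n + 1) x s = approx e n x s := by
  induction n generalizing x s with
  | zero =>
    have : (approx e 1 x - approx e 0 x) s ∈ (⊥ : Submodule R (Multiset ι →₀ R)) :=
      degLT_induction _ _ (fun M hM => by omega) hs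
    simpa [sub_eq_zero] using this
  | succ n ih =>
    have : (approx e (n + 2) x - approx e (n + 1) x) s ∈ (⊥ : Submodule R (Multiset ι →₀ R)) := by
      refine degLT_induction _ _ (fun M hM => ?_) hs
      refine basis_induction e _ (((approx e (n + 2)).flip (mon R M) - (approx e (n + 1)).flip (mon R M)))
        (fun i => ?_) x
      simp only [LinearMap.flip_apply, LinearMap.sub_apply, Submodule.mem_bot]
      rw [approx_succ_mon, approx_succ_mon, sub_eq_zero]
      by_cases hle : ∀ k ∈ M, i ≤ k
      · rw [step_of_le e _ hle, step_of_le e _ hle]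
      · push Not at hle
        obtain ⟨k, hk, hki⟩ := hle
        obtain ⟨j, N, hs⟩ := exists_isMinSplit (M := M) (by rintro rfl; simp at hk)
        have hj : j < i := by
          rcases Multiset.mem_cons.1 (hs.1 ▸ hk) with rfl | h
          · exact hki
          · exact (hs.2 k h).trans_lt hki
        have hc : M.card = N.card + 1 := by rw [hs.1]; simp
        have hN : mon R N ∈ degLT R ι n := mon_mem (by omega)
        rw [step_of_lt e _ hs hj, step_of_lt e _ hs hj, ih _ hN, ih _ hN, ih]
        exact degLT_mono (by omega) (leadingMul_approx e n i N (by omega))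
    simpa [sub_eq_zero] using this

/-- The action of `L` on the symmetric algebra. -/
def act (e : Basis ι R L) : L →ₗ[R] Module.End R (Multiset ι →₀ R) :=
  LinearMap.flip (Finsupp.linearCombination R fun M => (approx e (M.card + 1)).flip (mon R M))

lemma act_mon (e : Basis ι R L) (x : L) (M : Multiset ι) :
    act e x (mon R M) = approx e (M.card + 1) x (mon R M) := by
  simp [act, mon]

lemma approx_eq_act (e : Basis ι R L) (n : ℕ) (x : L) {s} (hs : s ∈ degLT R ι n) :
    approx e n x s = act e x s := by
  have : (approx e n x - act e x) s ∈ (⊥ : Submodule R (Multiset ι →₀ R)) := by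
    refine degLT_induction _ _ (fun M hM => ?_) hs
    obtain ⟨d, rfl⟩ := Nat.exists_eq_add_of_le (Nat.succ_le_of_lt hM)
    simp only [LinearMap.sub_apply, Submodule.mem_bot, sub_eq_zero, act_mon]
    clear hM hs
    induction d with
    | zero => rfl
    | succ d ih =>
      rw [← ih]
      exact approx_succ_apply e _ x (mon_mem (by simp [Nat.succ_eq_add_one]; omega))
  simpa [sub_eq_zero] using this

lemma act_mon_of_le (e : Basis ι R L) {i : ι} {M : Multiset ι} (h : ∀ k ∈ M, i ≤ k) :
    act e (e i) (mon R M) = mon R (i ::ₘ M) := by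
  rw [act_mon, approx_succ_mon, step_of_le e _ h]

lemma act_sub_mem (e : Basis ι R L) (i : ι) (M : Multiset ι) :
    act e (e i) (mon R M) - mon R (i ::ₘ M) ∈ degLT R ι (M.card + 1) := by
  rw [act_mon]
  exact leadingMul_approx e _ i M (by omega)

/-- The bracket relation holds here by construction: it is the recursive clause of `step`, once the
approximations are replaced by their common limit. -/
lemma act_lie_of_lt (e : Basis ι R L) {i j : ι} {N : Multiset ι} (hN : ∀ k ∈ N, j ≤ k)
    (hj : j < i) :
    act e (e i) (act e (e j) (mon R N)) =
      act e (e j) (act e (e i) (mon R N)) + act e ⁅e i, e j⁆ (mon R N) := by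
  have hm : mon R N ∈ degLT R ι (N.card + 1) := mon_mem (by omega)
  have hm' := leadingMul_approx e (N.card + 1) i N (by omega)
  rw [act_mon_of_le e hN, act_mon, approx_succ_mon,
    step_of_lt e _ (⟨rfl, hN⟩ : IsMinSplit (j ::ₘ N) j N) hj, Multiset.card_cons,
    approx_eq_act e _ _ hm', approx_eq_act e _ _ hm, approx_eq_act e _ _ hm, map_sub,
    act_mon_of_le e (i := j) (M := i ::ₘ N), Multiset.cons_swap]
  · abel
  · intro k hk
    rcases Multiset.mem_cons.1 hk with rfl | h
    · exact hj.le
    · exact hN k h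

/-- The defect of the action from being a Lie algebra homomorphism. -/
def defect (e : Basis ι R L) (s : Multiset ι →₀ R) : L →ₗ[R] L →ₗ[R] (Multiset ι →₀ R) :=
  LinearMap.mk₂ R (fun x y => act e x (act e y s) - act e y (act e x s) - act e ⁅x, y⁆ s)
    (by intros; simp; abel) (by intros; simp [smul_sub]) (by intros; simp; abel)
    (by intros; simp [smul_sub])

lemma defect_apply (e : Basis ι R L) (s : Multiset ι →₀ R) (x y : L) :
    defect e s x y = act e x (act e y s) - act e y (act e x s) - act e ⁅x, y⁆ s := rfl

lemma defect_eq_zero_of_basis (e : Basis ι R L) (s : Multiset ι →₀ R)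
    (h : ∀ i j, defect e s (e i) (e j) = 0) (x y : L) : defect e s x y = 0 := by
  have : defect e s = 0 := e.ext fun i => e.ext fun j => by simp [h]
  simp [this]

lemma defect_swap (e : Basis ι R L) (s : Multiset ι →₀ R) (x y : L) :
    defect e s x y = - defect e s y x := by
  rw [defect_apply, defect_apply, ← lie_skew y x]
  simp only [map_neg, LinearMap.neg_apply]
  abel

lemma act_act (e : Basis ι R L) {s : Multiset ι →₀ R} {x y : L} (h : defect e s x y = 0) :
    act e x (act e y s) = act e y (act e x s) + act e ⁅x, y⁆ s := by
  rw [defect_apply, sub_sub, sub_eq_zero] at h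
  exact h

lemma defect_mon_of_lt (e : Basis ι R L) {i j : ι} {N : Multiset ι} (hN : ∀ k ∈ N, j ≤ k)
    (hj : j < i) : defect e (mon R N) (e i) (e j) = 0 := by
  rw [defect_apply, act_lie_of_lt e hN hj]
  abel

lemma defect_of_mem (e : Basis ι R L) {n : ℕ}
    (h : ∀ M : Multiset ι, M.card < n → ∀ x y, defect e (mon R M) x y = 0) {s}
    (hs : s ∈ degLT R ι n) (x y : L) : defect e s x y = 0 := by
  have := degLT_induction (⊥ : Submodule R (Multiset ι →₀ R))
    (act e x ∘ₗ act e y - act e y ∘ₗ act e x - act e ⁅x, y⁆) (fun M hM => h M hM x y) hs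
  exact this

/-- The Jacobi identity enters here. Moving `c` to the left past `a` and `b` in both orders turns
the defect on `c s` into relations on `s`, `a s` and `b s`; the leftover terms cancel by Jacobi. -/
lemma defect_act_eq_zero (e : Basis ι R L) (s : Multiset ι →₀ R) (a b c : L)
    (h : ∀ x y, defect e s x y = 0) (hb : defect e (act e b s) a c = 0)
    (ha : defect e (act e a s) b c = 0) : defect e (act e c s) a b = 0 := by
  have h1 : act e a (act e b (act e c s)) = act e c (act e a (act e b s)) +
      act e ⁅a, c⁆ (act e b s) + act e ⁅b, c⁆ (act e a s) + act e ⁅a, ⁅b, c⁆⁆ s := by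
    rw [act_act e (h b c), map_add, act_act e hb, act_act e (h a ⁅b, c⁆)]
    abel
  have h2 : act e b (act e a (act e c s)) = act e c (act e b (act e a s)) +
      act e ⁅b, c⁆ (act e a s) + act e ⁅a, c⁆ (act e b s) + act e ⁅b, ⁅a, c⁆⁆ s := by
    rw [act_act e (h a c), map_add, act_act e ha, act_act e (h b ⁅a, c⁆)]
    abel
  rw [defect_apply, h1, h2, act_act e (h ⁅a, b⁆ c), act_act e (h a b), leibniz_lie a b c]
  simp only [map_add, LinearMap.add_apply]
  abel

/-- Strong induction on the degree. If neither index is minimal, strip the least index `k` of the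
monomial and apply `defect_act_eq_zero` with `c = e k`; the relations it asks for involve `k`, so
they hold by construction up to terms of lower degree. -/
lemma defect_mon (e : Basis ι R L) (M : Multiset ι) (x y : L) : defect e (mon R M) x y = 0 := by
  induction hn : M.card using Nat.strong_induction_on generalizing M x y with
  | _ n ih =>
  subst hn
  have low {s} (hs : s ∈ degLT R ι M.card) (x y : L) : defect e s x y = 0 :=
    defect_of_mem e (fun M' hM' x y => ih _ hM' M' x y rfl) hs x y
  have key {i j : ι} (hij : i < j) : defect e (mon R M) (e i) (e j) = 0 := by
    by_cases hle : ∀ k ∈ M, i ≤ k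
    · rw [defect_swap, defect_mon_of_lt e hle hij, neg_zero]
    push Not at hle
    obtain ⟨l, hl, hli⟩ := hle
    obtain ⟨k, N, rfl, hN⟩ := exists_isMinSplit (M := M) (by rintro rfl; simp at hl)
    have hki : k < i := by
      rcases Multiset.mem_cons.1 hl with rfl | h
      · exact hli
      · exact (hN l h).trans_lt hli
    rw [Multiset.card_cons] at low
    -- Modulo lower degree, `e b` sends `N` to `b ::ₘ N`, whose least index is still at least `k`.
    have hact {a b : ι} (ha : k < a) (hb : k < b) :
        defect e (act e (e b) (mon R N)) (e a) (e k) = 0 := by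
      have h1 := low (act_sub_mem e b N) (e a) (e k)
      have h2 : defect e (mon R (b ::ₘ N)) (e a) (e k) = 0 :=
        defect_mon_of_lt e (fun l hl => by
          rcases Multiset.mem_cons.1 hl with rfl | h
          · exact hb.le
          · exact hN l h) ha
      rw [defect_apply] at h1 h2 ⊢
      simp only [map_sub] at h1
      have h3 := congrArg₂ (· + ·) h1 h2
      simp only [add_zero] at h3
      refine Eq.trans ?_ h3
      abel
    rw [← act_mon_of_le e hN]
    exact defect_act_eq_zero e _ _ _ _ (low (mon_mem (by omega)))
      (hact hki (hki.trans hij)) (hact (hki.trans hij) hki)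
  refine defect_eq_zero_of_basis e _ (fun i j => ?_) x y
  rcases lt_trichotomy i j with hij | rfl | hij
  · exact key hij
  · simp [defect_apply]
  · rw [defect_swap, key hij, neg_zero]

/-- The representation of `L` on the symmetric algebra of its underlying module. -/
def rep (e : Basis ι R L) : L →ₗ⁅R⁆ Module.End R (Multiset ι →₀ R) :=
  { act e with
    map_lie' := by
      intro x y
      refine Finsupp.lhom_ext' fun M => LinearMap.ext_ring ?_
      have h := defect_mon e M x y
      rw [defect_apply, sub_eq_zero] at h
      exact h.symm }

/-- Acting on the monomial 1 returns `x` itself as a linear form, so its coordinates can be read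
off. -/
lemma rep_injective (e : Basis ι R L) {x : L} (hx : rep e x (mon R 0) = 0) : x = 0 := by
  have h : (Finsupp.mapDomain (fun i => ({i} : Multiset ι)) (e.repr x)) = 0 := by
    rw [← hx]
    have : (Finsupp.lmapDomain R R fun i => ({i} : Multiset ι)) ∘ₗ e.repr.toLinearMap =
        (act e).flip (mon R 0) := by
      refine e.ext fun i => ?_
      rw [LinearMap.flip_apply, act_mon_of_le e (by simp)]
      simp [mon]
    exact LinearMap.congr_fun this x
  have h' := Finsupp.mapDomain_injective (M := R) (f := fun i => ({i} : Multiset ι))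
    (fun _ _ => Multiset.singleton_inj.1) (h.trans Finsupp.mapDomain_zero.symm)
  simpa using h'

end PoincareBirkhoffWitt

namespace QuasiWhittaker

open Module

attribute [local instance 100] LieRing.ofAssociativeRing

/-! ### Generator and universal property of the induced module. -/

section Universal

variable {R L : Type*} [CommRing R] [LieRing L] [LieAlgebra R L] {p : LieIdeal R L}

/-- The stabiliser of `N` is a subalgebra containing `L`. By the universal property, the inclusion
of this subalgebra has a section, so it is everything. -/
lemma mem_of_enveloping_smul {V : Type*} [AddCommGroup V] [Module R V]
    [Module (UniversalEnvelopingAlgebra R L) V] [IsScalarTower R (UniversalEnvelopingAlgebra R L) V]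
    (N : Submodule R V)
    (hN : ∀ (x : L), ∀ v ∈ N, UniversalEnvelopingAlgebra.ι R x • v ∈ N)
    (u : UniversalEnvelopingAlgebra R L) {v : V} (hv : v ∈ N) : u • v ∈ N := by
  let A : Subalgebra R (UniversalEnvelopingAlgebra R L) :=
    { carrier := {u | ∀ v ∈ N, u • v ∈ N}
      mul_mem' := fun {a b} ha hb v hv => by
        rw [mul_smul]
        exact ha _ (hb v hv)
      add_mem' := fun {a b} ha hb v hv => by
        rw [add_smul]
        exact add_mem (ha v hv) (hb v hv)
      algebraMap_mem' := fun r v hv => by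
        rw [algebraMap_smul]
        exact N.smul_mem r hv }
  let f : L →ₗ⁅R⁆ A :=
    { toFun := fun x => ⟨UniversalEnvelopingAlgebra.ι R x, hN x⟩
      map_add' := fun x y => Subtype.ext (map_add _ x y)
      map_smul' := fun r x => Subtype.ext (map_smul _ r x)
      map_lie' := fun {x y} => Subtype.ext (LieHom.map_lie _ x y) }
  have h : A.val.comp (UniversalEnvelopingAlgebra.lift R f) = AlgHom.id R _ := by
    refine UniversalEnvelopingAlgebra.hom_ext R ?_
    refine LieHom.ext fun x => ?_
    change ((UniversalEnvelopingAlgebra.lift R f (UniversalEnvelopingAlgebra.ι R x) : A) :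
      UniversalEnvelopingAlgebra R L) = UniversalEnvelopingAlgebra.ι R x
    rw [UniversalEnvelopingAlgebra.lift_ι_apply]
    rfl
  have hu : u ∈ A := by
    have := (UniversalEnvelopingAlgebra.lift R f u).2
    have h' := DFunLike.congr_fun h u
    change ((UniversalEnvelopingAlgebra.lift R f u : A) : UniversalEnvelopingAlgebra R L) = u at h'
    rwa [h'] at this
  exact hu v hv

/-- A linear map intertwining the actions of `L` intertwines the actions of `U(L)`. -/
lemma intertwine_enveloping {V N : Type*} [AddCommGroup V] [Module R V] [AddCommGroup N]
    [Module R N] (s : UniversalEnvelopingAlgebra R L →ₐ[R] Module.End R N)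
    (s' : UniversalEnvelopingAlgebra R L →ₐ[R] Module.End R V) (f : V →ₗ[R] N)
    (hf : ∀ x v, s (UniversalEnvelopingAlgebra.ι R x) (f v) =
      f (s' (UniversalEnvelopingAlgebra.ι R x) v))
    (u : UniversalEnvelopingAlgebra R L) (v : V) : s u (f v) = f (s' u v) := by
  let _ : Module (UniversalEnvelopingAlgebra R L) N := Module.compHom N s.toRingHom
  let _ : Module (UniversalEnvelopingAlgebra R L) V := Module.compHom V s'.toRingHom
  have smul_N (u : UniversalEnvelopingAlgebra R L) (n : N) : u • n = s u n := rfl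
  have smul_V (u : UniversalEnvelopingAlgebra R L) (n : V) : u • n = s' u n := rfl
  have _ : IsScalarTower R (UniversalEnvelopingAlgebra R L) N := ⟨fun r u n => by
    rw [smul_N, smul_N, map_smul, LinearMap.smul_apply]⟩
  have _ : IsScalarTower R (UniversalEnvelopingAlgebra R L) V := ⟨fun r u n => by
    rw [smul_V, smul_V, map_smul, LinearMap.smul_apply]⟩
  -- Intertwining says that the graph of `f` is stable, so stability under `L` suffices.
  have h := mem_of_enveloping_smul (V := V × N) f.graph (fun x y hy => by
    rw [LinearMap.mem_graph_iff] at hy ⊢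
    rw [Prod.smul_snd, Prod.smul_fst, hy, smul_N, smul_V, hf]) u
      (v := (v, f v)) ((f.mem_graph_iff _).2 rfl)
  exact (f.mem_graph_iff _).1 h

variable (φ : LieAlgebra.LieCharacter R p)

/-- The underlying module of `R w_φ` is `R`. -/
def rankOneEquiv : RankOne φ ≃ₗ[R] R := LinearEquiv.refl R R

lemma rankOneEquiv_lie (q : p) (m : RankOne φ) :
    rankOneEquiv φ ⁅q, m⁆ = φ q * rankOneEquiv φ m := rfl

/-- The generating vector `1 ⊗ w_φ` of `W(φ)`. -/
def cyclicVector : W φ :=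
  Submodule.Quotient.mk ((1 : UniversalEnvelopingAlgebra R L) ⊗ₜ[R] (rankOneEquiv φ).symm 1)

lemma mk_tmul (u : UniversalEnvelopingAlgebra R L) (m : RankOne φ) :
    (Submodule.Quotient.mk (u ⊗ₜ[R] m) : W φ) = rankOneEquiv φ m • (u • cyclicVector φ) := by
  have h : (u ⊗ₜ[R] m : UniversalEnvelopingAlgebra R L ⊗[R] RankOne φ) =
      rankOneEquiv φ m •
        (u • ((1 : UniversalEnvelopingAlgebra R L) ⊗ₜ[R] (rankOneEquiv φ).symm 1)) := by
    rw [TensorProduct.smul_tmul', smul_eq_mul, mul_one, ← TensorProduct.tmul_smul, ← map_smul,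
      smul_eq_mul, mul_one, LinearEquiv.symm_apply_apply]
  rw [h]
  rfl

lemma lie_cyclicVector (q : p) : ⁅(q : L), cyclicVector φ⁆ = φ q • cyclicVector φ := by
  have h1 : φ q • cyclicVector φ = Submodule.Quotient.mk
      ((1 : UniversalEnvelopingAlgebra R L) ⊗ₜ[R] (rankOneEquiv φ).symm (φ q)) := by
    rw [mk_tmul, one_smul, LinearEquiv.apply_symm_apply]
  have h2 : ⁅(q : L), cyclicVector φ⁆ = Submodule.Quotient.mk
      ((UniversalEnvelopingAlgebra.ι R (q : L)) ⊗ₜ[R] (rankOneEquiv φ).symm 1) := by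
    rw [mk_tmul, LinearEquiv.apply_symm_apply, one_smul]
    rfl
  rw [h1, h2]
  refine (Submodule.Quotient.eq _).2 (Submodule.subset_span
    ⟨1, UniversalEnvelopingAlgebra.ι R q, (rankOneEquiv φ).symm 1, ?_⟩)
  have e1 : envelopingIncl R p (UniversalEnvelopingAlgebra.ι R q) =
      UniversalEnvelopingAlgebra.ι R (q : L) := UniversalEnvelopingAlgebra.lift_ι_apply R _ q
  have e2 : envelopingAction R p (RankOne φ) (UniversalEnvelopingAlgebra.ι R q) =
      LieModule.toEnd R p (RankOne φ) q := UniversalEnvelopingAlgebra.lift_ι_apply R _ q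
  rw [e1, e2, one_mul]
  congr 2
  apply (rankOneEquiv φ).injective
  rw [LieModule.toEnd_apply_apply, rankOneEquiv_lie]
  simp

lemma eq_top_of_cyclicVector_mem (N : Submodule R (W φ)) (hN : ∀ (x : L), ∀ v ∈ N, ⁅x, v⁆ ∈ N)
    (hw : cyclicVector φ ∈ N) : N = ⊤ := by
  refine eq_top_iff.2 fun v _ => ?_
  obtain ⟨z, rfl⟩ := Submodule.Quotient.mk_surjective _ v
  induction z using TensorProduct.induction_on with
  | zero => exact N.zero_mem
  | tmul u m =>
    change Submodule.Quotient.mk (u ⊗ₜ[R] m) ∈ N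
    rw [mk_tmul]
    exact N.smul_mem _ (mem_of_enveloping_smul N hN u hw)
  | add a b ha hb => exact N.add_mem (ha trivial) (hb trivial)

/-- The universal property of `W(φ)`. -/
theorem exists_hom_of_whittaker {N : Type*} [AddCommGroup N] [Module R N]
    (σ : L →ₗ⁅R⁆ Module.End R N) (δ : N) (hδ : ∀ q : p, σ (q : L) δ = φ q • δ) :
    ∃ T : W φ →ₗ[R] N, T (cyclicVector φ) = δ ∧ ∀ (x : L) v, T ⁅x, v⁆ = σ x (T v) := by
  let U := UniversalEnvelopingAlgebra R L
  let s : U →ₐ[R] Module.End R N := UniversalEnvelopingAlgebra.lift R σ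
  have hs (x : L) : s (UniversalEnvelopingAlgebra.ι R x) = σ x :=
    UniversalEnvelopingAlgebra.lift_ι_apply R σ x
  let _ : Module U N := Module.compHom N s.toRingHom
  have smul_def (u : U) (n : N) : u • n = s u n := rfl
  have _ : IsScalarTower R U N := ⟨fun r u n => by
    rw [smul_def, smul_def, map_smul, LinearMap.smul_apply]⟩
  let T₀ : U ⊗[R] RankOne φ →ₗ[U] N :=
    TensorProduct.AlgebraTensorModule.lift
      (LinearMap.toSpanSingleton U (RankOne φ →ₗ[R] N)
        (LinearMap.toSpanSingleton R N δ ∘ₗ (rankOneEquiv φ).toLinearMap))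
  have hT₀ (u : U) (m : RankOne φ) : T₀ (u ⊗ₜ[R] m) = s u (rankOneEquiv φ m • δ) := rfl
  have hact (a : UniversalEnvelopingAlgebra R p) (m : RankOne φ) :
      s (envelopingIncl R p a) (rankOneEquiv φ m • δ) =
        rankOneEquiv φ (envelopingAction R p (RankOne φ) a m) • δ :=
    intertwine_enveloping (s.comp (envelopingIncl R p)) (envelopingAction R p (RankOne φ))
      (LinearMap.toSpanSingleton R N δ ∘ₗ (rankOneEquiv φ).toLinearMap) (fun q m => by
        have e1 : envelopingIncl R p (UniversalEnvelopingAlgebra.ι R q) =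
          UniversalEnvelopingAlgebra.ι R (q : L) := UniversalEnvelopingAlgebra.lift_ι_apply R _ q
        have e2 : envelopingAction R p (RankOne φ) (UniversalEnvelopingAlgebra.ι R q) =
          LieModule.toEnd R p (RankOne φ) q := UniversalEnvelopingAlgebra.lift_ι_apply R _ q
        rw [AlgHom.comp_apply, e1, e2, hs]
        simp [rankOneEquiv_lie, hδ, smul_smul, mul_comm]) a m
  have hle : indRelations R p (RankOne φ) ≤ LinearMap.ker T₀ := by
    rw [indRelations, Submodule.span_le]
    rintro _ ⟨u, a, m, rfl⟩
    rw [SetLike.mem_coe, LinearMap.mem_ker, map_sub, hT₀, hT₀, map_mul, Module.End.mul_apply,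
      hact, sub_self]
  refine ⟨((indRelations R p (RankOne φ)).liftQ T₀ hle).restrictScalars R, ?_, ?_⟩
  · change T₀ (1 ⊗ₜ[R] (rankOneEquiv φ).symm 1) = δ
    rw [hT₀, LinearEquiv.apply_symm_apply, one_smul, map_one, Module.End.one_apply]
  · intro x v
    change (indRelations R p (RankOne φ)).liftQ T₀ hle (UniversalEnvelopingAlgebra.ι R x • v) = _
    rw [map_smul, smul_def, hs]
    rfl

end Universal

/-! ### Derivations of a polynomial ring induced by a Lie module. -/

section Polynomial

variable (K : Type*) {L : Type*} (A : Type*) [Field K] [LieRing L]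
  [AddCommGroup A] [Module K A] [LieRingModule L A]

/-- The polynomial ring on a vector space, in the coordinates of a chosen basis. -/
abbrev Poly : Type _ := MvPolynomial (Basis.ofVectorSpaceIndex K A) K

/-- The inclusion of a vector space as the linear forms of its polynomial ring. -/
def linForm : A →ₗ[K] Poly K A := (Basis.ofVectorSpace K A).constr K MvPolynomial.X

lemma linForm_basis (i : Basis.ofVectorSpaceIndex K A) :
    linForm K A (Basis.ofVectorSpace K A i) = MvPolynomial.X i := by
  rw [linForm, Basis.constr_basis]

/-- The action of `L` on the polynomial ring of an `L`-module by derivations. -/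
def der (y : L) : Derivation K (Poly K A) (Poly K A) :=
  MvPolynomial.mkDerivation K fun i => linForm K A ⁅y, Basis.ofVectorSpace K A i⁆

variable {A}

lemma der_X (y : L) (i : Basis.ofVectorSpaceIndex K A) :
    der K A y (MvPolynomial.X i) = linForm K A ⁅y, Basis.ofVectorSpace K A i⁆ :=
  MvPolynomial.mkDerivation_X K _ i

lemma der_add (y z : L) : der K A (y + z) = der K A y + der K A z :=
  MvPolynomial.derivation_ext fun i => by simp [der_X]

/-- Evaluation of polynomials at a linear functional. -/
def evalAt (ψ : A →ₗ[K] K) : Poly K A →ₐ[K] K :=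
  MvPolynomial.aeval fun i => ψ (Basis.ofVectorSpace K A i)

lemma evalAt_linForm (ψ : A →ₗ[K] K) (a : A) : evalAt K ψ (linForm K A a) = ψ a := by
  have : (evalAt K ψ).toLinearMap ∘ₗ linForm K A = ψ := by
    refine (Basis.ofVectorSpace K A).ext fun i => ?_
    rw [LinearMap.comp_apply, linForm_basis, AlgHom.toLinearMap_apply, evalAt, MvPolynomial.aeval_X]
  exact LinearMap.congr_fun this a

/-- `f ↦ (x f)(ψ)` is a point derivation at `ψ`, so it vanishes as soon as it kills the linear
forms. -/
lemma evalAt_der (ψ : A →ₗ[K] K) {x : L} (hx : ∀ a : A, ψ ⁅x, a⁆ = 0) (f : Poly K A) :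
    evalAt K ψ (der K A x f) = 0 := by
  induction f using MvPolynomial.induction_on with
  | C r => simp
  | add f g hf hg => simp [hf, hg]
  | mul_X f i hf => simp [hf, der_X, evalAt_linForm, hx]

variable [LieAlgebra K L] [LieModule K L A]

lemma der_linForm (y : L) (a : A) : der K A y (linForm K A a) = linForm K A ⁅y, a⁆ := by
  have : (der K A y : Poly K A →ₗ[K] Poly K A) ∘ₗ linForm K A =
      linForm K A ∘ₗ (LieModule.toEnd K L A y) := by
    refine (Basis.ofVectorSpace K A).ext fun i => ?_
    simp only [LinearMap.comp_apply, LieModule.toEnd_apply_apply, linForm_basis]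
    exact der_X K y i
  exact LinearMap.congr_fun this a

lemma der_smul (r : K) (y : L) : der K A (r • y) = r • der K A y :=
  MvPolynomial.derivation_ext fun i => by simp [der_X]

lemma der_lie (y z : L) : der K A ⁅y, z⁆ = ⁅der K A y, der K A z⁆ :=
  MvPolynomial.derivation_ext fun i => by
    simp [der_X, der_linForm, Derivation.commutator_apply, lie_lie]

end Polynomial

/-! ### The semidirect product acting on polynomials and on functionals. -/

section Projection

variable {K L : Type*} [Field K] [LieRing L] [LieAlgebra K L]
  {g₀ : LieSubalgebra K L} {p : LieIdeal K L} (h : IsCompl g₀.toSubmodule p.toSubmodule)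

/-- The projection onto the ideal along the complementary subalgebra. -/
def projIdeal : L →ₗ[K] p := p.toSubmodule.projectionOnto g₀.toSubmodule h.symm

/-- The projection onto the subalgebra along the complementary ideal, as a linear map. -/
def projSubAux : L →ₗ[K] g₀ := g₀.toSubmodule.projectionOnto p.toSubmodule h

lemma projSubAux_add_projIdeal (y : L) : (projSubAux h y : L) + projIdeal h y = y :=
  Submodule.projection_add_projection_eq_self h y

lemma proj_unique {y : L} {a : g₀} {u : p} (hy : y = a + u) :
    projSubAux h y = a ∧ projIdeal h y = u := by
  subst hy
  constructor
  · rw [map_add]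
    have h1 : projSubAux h (a : L) = a := Submodule.projectionOnto_apply_left h a
    have h2 : projSubAux h (u : L) = 0 := Submodule.projectionOnto_apply_right h u
    rw [h1, h2, add_zero]
  · rw [map_add]
    have h1 : projIdeal h (a : L) = 0 := Submodule.projectionOnto_apply_right h.symm a
    have h2 : projIdeal h (u : L) = u := Submodule.projectionOnto_apply_left h.symm u
    rw [h1, h2, zero_add]

lemma proj_lie (y z : L) :
    projSubAux h ⁅y, z⁆ = ⁅projSubAux h y, projSubAux h z⁆ ∧
    (projIdeal h ⁅y, z⁆ : L) = ⁅(projSubAux h y : L), (projIdeal h z : L)⁆ -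
      ⁅(projSubAux h z : L), (projIdeal h y : L)⁆ + ⁅(projIdeal h y : L), (projIdeal h z : L)⁆ := by
  have key : ⁅y, z⁆ = ((⁅projSubAux h y, projSubAux h z⁆ : g₀) : L) +
      ((⁅(projSubAux h y : L), projIdeal h z⁆ - ⁅(projSubAux h z : L), projIdeal h y⁆ +
        ⁅projIdeal h y, projIdeal h z⁆ : p) : L) := by
    conv_lhs => rw [← projSubAux_add_projIdeal h y, ← projSubAux_add_projIdeal h z]
    have e : (((⁅(projSubAux h y : L), projIdeal h z⁆ - ⁅(projSubAux h z : L), projIdeal h y⁆ +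
        ⁅projIdeal h y, projIdeal h z⁆ : p)) : L) =
        ⁅(projSubAux h y : L), (projIdeal h z : L)⁆ - ⁅(projSubAux h z : L), (projIdeal h y : L)⁆ +
        ⁅(projIdeal h y : L), (projIdeal h z : L)⁆ := rfl
    rw [e, add_lie, lie_add, lie_add, LieSubalgebra.coe_bracket,
      ← lie_skew (projSubAux h z : L) (projIdeal h y : L)]
    abel
  obtain ⟨h1, h2⟩ := proj_unique h key
  exact ⟨h1, congrArg Subtype.val h2⟩

/-- The projection onto the subalgebra along the complementary ideal. -/
def projSub : L →ₗ⁅K⁆ g₀ :=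
  { projSubAux h with map_lie' := fun {y z} => (proj_lie h y z).1 }

lemma projSub_add_projIdeal (y : L) : (projSub h y : L) + projIdeal h y = y :=
  projSubAux_add_projIdeal h y

lemma projSub_coe (a : g₀) : projSub h (a : L) = a :=
  (proj_unique h (y := a) (a := a) (u := 0) (by simp)).1

lemma projIdeal_coe_sub (a : g₀) : projIdeal h (a : L) = 0 :=
  (proj_unique h (y := a) (a := a) (u := 0) (by simp)).2

lemma projSub_coe_ideal (u : p) : projSub h (u : L) = 0 :=
  (proj_unique h (y := u) (a := 0) (u := u) (by simp)).1

lemma projIdeal_coe (u : p) : projIdeal h (u : L) = u :=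
  (proj_unique h (y := u) (a := 0) (u := u) (by simp)).2

lemma projIdeal_lie (y z : L) :
    (projIdeal h ⁅y, z⁆ : L) = ⁅(projSub h y : L), (projIdeal h z : L)⁆ -
      ⁅(projSub h z : L), (projIdeal h y : L)⁆ + ⁅(projIdeal h y : L), (projIdeal h z : L)⁆ :=
  (proj_lie h y z).2

/-- The largest quotient of `L` in which the ideal `p` becomes abelian, as an `L`-module. -/
abbrev AbQuot (p : LieIdeal K L) : Type _ := L ⧸ (⁅p, p⁆ : LieIdeal K L)

/-- An element of `L` as a linear form on the dual of `AbQuot p`. -/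
def form (p : LieIdeal K L) : L →ₗ[K] Poly K (AbQuot p) :=
  linForm K (AbQuot p) ∘ₗ (⁅p, p⁆ : LieIdeal K L).toSubmodule.mkQ

lemma der_form (y z : L) : der K (AbQuot p) y (form p z) = form p ⁅y, z⁆ :=
  der_linForm K y _

lemma form_eq_zero {z : L} (hz : z ∈ (⁅p, p⁆ : LieIdeal K L)) : form p z = 0 := by
  have : (⁅p, p⁆ : LieIdeal K L).toSubmodule.mkQ z = 0 :=
    (Submodule.Quotient.mk_eq_zero _).2 hz
  rw [form, LinearMap.comp_apply, this, map_zero]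

/-- `L` acts on polynomials: the subalgebra by derivations, the ideal by multiplication. -/
def polyRep : L →ₗ⁅K⁆ Module.End K (Poly K (AbQuot p)) where
  toFun y := (der K (AbQuot p) (projSub h y : L)).toLinearMap -
    LinearMap.mulLeft K (form p (projIdeal h y))
  map_add' y z := by
    refine LinearMap.ext fun f => ?_
    simp [der_add, add_mul]
    abel
  map_smul' r y := by
    refine LinearMap.ext fun f => ?_
    simp [der_smul, smul_sub]
  map_lie' {y z} := by
    refine LinearMap.ext fun f => ?_
    -- Multiplication operators commute, so brackets within `p` must act by zero; passing to the
    -- quotient by `⁅p, p⁆` ensures this.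
    have h0 : form p ⁅(projIdeal h y : L), (projIdeal h z : L)⁆ = 0 :=
      form_eq_zero (LieSubmodule.lie_mem_lie (projIdeal h y).2 (projIdeal h z).2)
    rw [projIdeal_lie, LieHom.map_lie, LieSubalgebra.coe_bracket, der_lie, map_add, map_sub, h0,
      LieRing.of_associative_ring_bracket]
    simp only [LinearMap.sub_apply, Module.End.mul_apply, LinearMap.mulLeft_apply, map_sub,
      Derivation.coeFn_coe, Derivation.commutator_apply,
      Derivation.leibniz, der_form, smul_eq_mul]
    ring

lemma polyRep_apply (y : L) (f : Poly K (AbQuot p)) : polyRep h y f =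
    der K (AbQuot p) (projSub h y : L) f - form p (projIdeal h y) * f := rfl

variable (φ : LieAlgebra.LieCharacter K p)

/-- The extension of a character of `p` by zero on the complement, on `AbQuot p`. -/
def extendChar : AbQuot p →ₗ[K] K :=
  (⁅p, p⁆ : LieIdeal K L).toSubmodule.liftQ (φ.toLinearMap ∘ₗ projIdeal h) <| by
    rw [LieSubmodule.lieIdeal_oper_eq_linear_span, Submodule.span_le]
    rintro _ ⟨x, n, rfl⟩
    have : ⁅(x : L), (n : L)⁆ = ((⁅x, n⁆ : p) : L) := rfl
    rw [SetLike.mem_coe, LinearMap.mem_ker, LinearMap.comp_apply, this, projIdeal_coe]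
    exact LieAlgebra.lieCharacter_apply_lie φ x n

lemma extendChar_mk (z : L) :
    extendChar h φ ((⁅p, p⁆ : LieIdeal K L).toSubmodule.mkQ z) = φ (projIdeal h z) := rfl

lemma evalAt_form (z : L) : evalAt K (extendChar h φ) (form p z) = φ (projIdeal h z) := by
  rw [form, LinearMap.comp_apply, evalAt_linForm, extendChar_mk]

/-- The extended character ignores `g₀`, and `⁅x, g₀⁆` stays in `g₀`; hence only the brackets of `x`
with `p` matter. -/
lemma evalAt_der_eq_zero (x : g₀) (hx : ∀ q : p, φ ⁅(x : L), q⁆ = 0) (f : Poly K (AbQuot p)) :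
    evalAt K (extendChar h φ) (der K (AbQuot p) (x : L) f) = 0 := by
  refine evalAt_der K _ (fun a => ?_) f
  obtain ⟨z, rfl⟩ := Submodule.mkQ_surjective _ a
  change φ (projIdeal h ⁅(x : L), z⁆) = 0
  rw [← hx (projIdeal h z)]
  congr 1
  refine Subtype.ext ?_
  rw [projIdeal_lie, projSub_coe, projIdeal_coe_sub]
  simp

variable {S : Type*} [AddCommGroup S] [Module K S]

/-- The contragredient action on `S`-valued functionals on polynomials, for an action of the
subalgebra on `S`. -/
def dualRep (τ : g₀ →ₗ⁅K⁆ Module.End K S) :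
    L →ₗ⁅K⁆ Module.End K (Poly K (AbQuot p) →ₗ[K] S) where
  toFun y := LinearMap.compRight K (τ (projSub h y)) - LinearMap.lcomp K S (polyRep h y)
  map_add' y z := by
    refine LinearMap.ext fun f => LinearMap.ext fun a => ?_
    simp
    abel
  map_smul' r y := by
    refine LinearMap.ext fun f => LinearMap.ext fun a => ?_
    simp [smul_sub]
  map_lie' {y z} := by
    refine LinearMap.ext fun f => LinearMap.ext fun a => ?_
    simp [LieRing.of_associative_ring_bracket]
    abel

lemma dualRep_apply (τ : g₀ →ₗ⁅K⁆ Module.End K S) (y : L) (δ : Poly K (AbQuot p) →ₗ[K] S)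
    (f : Poly K (AbQuot p)) :
    dualRep h τ y δ f = τ (projSub h y) (δ f) - δ (polyRep h y f) := rfl

/-- Evaluation at the character `φ`, with values in the line through `v`. -/
def delta (v : S) : Poly K (AbQuot p) →ₗ[K] S :=
  LinearMap.toSpanSingleton K S v ∘ₗ (evalAt K (extendChar h φ)).toLinearMap

lemma delta_apply (v : S) (f : Poly K (AbQuot p)) :
    delta h φ v f = evalAt K (extendChar h φ) f • v := rfl

lemma delta_one (v : S) : delta h φ v 1 = v := by simp [delta_apply]

/-- The minus sign in `polyRep` cancels the contragredient one, so `q` multiplies by the value of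
its form at `φ`. -/
lemma dualRep_delta_ideal (τ : g₀ →ₗ⁅K⁆ Module.End K S) (v : S) (q : p) :
    dualRep h τ (q : L) (delta h φ v) = φ q • delta h φ v := by
  refine LinearMap.ext fun f => ?_
  rw [dualRep_apply, polyRep_apply, projSub_coe_ideal, projIdeal_coe, delta_apply, delta_apply]
  have h0 : der K (AbQuot p) ((0 : g₀) : L) f = 0 := by
    have := der_smul (A := AbQuot p) K (0 : K) (0 : L)
    rw [zero_smul, zero_smul] at this
    rw [ZeroMemClass.coe_zero, this]
    rfl
  rw [h0, map_zero, zero_sub, map_neg, map_mul, evalAt_form, projIdeal_coe]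
  simp [delta_apply, mul_smul]

lemma dualRep_delta_sub (τ : g₀ →ₗ⁅K⁆ Module.End K S) (v : S) (x : g₀)
    (hx : ∀ q : p, φ ⁅(x : L), q⁆ = 0) :
    dualRep h τ (x : L) (delta h φ v) = delta h φ (τ x v) := by
  refine LinearMap.ext fun f => ?_
  rw [dualRep_apply, polyRep_apply, projSub_coe, projIdeal_coe_sub, delta_apply, delta_apply,
    delta_apply, map_sub, evalAt_der_eq_zero h φ x hx]
  simp

/-- For `v` in a module over the complementary subalgebra, there is an equivariant map from `W(φ)`
to the contragredient module sending the generator to evaluation at `φ` with values along `v`. -/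
theorem exists_hom_delta (τ : g₀ →ₗ⁅K⁆ Module.End K S) (v : S) :
    ∃ T : W φ →ₗ[K] (Poly K (AbQuot p) →ₗ[K] S), T (cyclicVector φ) = delta h φ v ∧
      ∀ (x : L) u, T ⁅x, u⁆ = dualRep h τ x (T u) :=
  exists_hom_of_whittaker φ (dualRep h τ) _ (dualRep_delta_ideal h φ τ v)

end Projection

/-! ### The word-length filtration and irreducibility. -/

section Filtration

variable {K L V ι : Type*} [Field K] [LieRing L] [AddCommGroup V] [Module K V] [LieRingModule L V]

/-- The vectors obtained from `w` by fewer than `n` applications of members of the family `x`. -/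
def filt (K : Type*) {L V ι : Type*} [Field K] [LieRing L] [AddCommGroup V] [Module K V]
    [LieRingModule L V] (x : ι → L) (w : V) : ℕ → Submodule K V
  | 0 => ⊥
  | n + 1 => Submodule.span K ({w} ∪ {u | ∃ j, ∃ v ∈ filt K x w n, u = ⁅x j, v⁆})

variable (x : ι → L) (w : V)

lemma mem_filt_succ (n : ℕ) : w ∈ filt K x w (n + 1) :=
  Submodule.subset_span (Or.inl rfl)

lemma lie_mem_filt {n : ℕ} (j : ι) {v : V} (hv : v ∈ filt K x w n) :
    ⁅x j, v⁆ ∈ filt K x w (n + 1) :=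
  Submodule.subset_span (Or.inr ⟨j, v, hv, rfl⟩)

lemma filt_le_succ (n : ℕ) : filt K x w n ≤ filt K x w (n + 1) := by
  induction n with
  | zero => exact bot_le
  | succ n ih =>
    refine Submodule.span_mono (Set.union_subset_union_right _ ?_)
    rintro _ ⟨j, v, hv, rfl⟩
    exact ⟨j, v, ih hv, rfl⟩

lemma filt_succ_induction {n : ℕ} {V' : Type*} [AddCommGroup V'] [Module K V']
    (f : V →ₗ[K] V') (P : Submodule K V') (hw : f w ∈ P)
    (hx : ∀ j, ∀ v ∈ filt K x w n, f ⁅x j, v⁆ ∈ P) {v : V} (hv : v ∈ filt K x w (n + 1)) :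
    f v ∈ P := by
  have : filt K x w (n + 1) ≤ P.comap f := by
    rw [filt, Submodule.span_le]
    rintro _ (rfl | ⟨j, v, hv, rfl⟩)
    · exact hw
    · exact hx j v hv
  exact this hv

variable [LieAlgebra K L] [LieModule K L V] {p : LieIdeal K L}

lemma lie_mem_filt_of_mem_span {n : ℕ} {y : L} (hy : y ∈ Submodule.span K (Set.range x)) {v : V}
    (hv : v ∈ filt K x w n) : ⁅y, v⁆ ∈ filt K x w (n + 1) := by
  have : Submodule.span K (Set.range x) ≤
      (filt K x w (n + 1)).comap ((LieModule.toEnd K L V : L →ₗ[K] Module.End K V).flip v) := by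
    rw [Submodule.span_le]
    rintro _ ⟨j, rfl⟩
    exact lie_mem_filt x w j hv
  exact this hy

/-- The operator `q - φ(q)`. -/
def shifted (φ : LieAlgebra.LieCharacter K p) (V : Type*) [AddCommGroup V] [Module K V]
    [LieRingModule L V] [LieModule K L V] (q : p) : Module.End K V :=
  LieModule.toEnd K L V (q : L) - φ q • (1 : Module.End K V)

variable {φ : LieAlgebra.LieCharacter K p}

lemma shifted_apply (q : p) (v : V) : shifted φ V q v = ⁅(q : L), v⁆ - φ q • v := rfl

/-- This is the commutation rule behind `-∂/∂y`: the scalar `-φ ⁅y, q⁆` is the only contribution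
that keeps `v` itself. -/
lemma shifted_lie (q : p) (y : L) (v : V) : shifted φ V q ⁅y, v⁆ =
    ⁅y, shifted φ V q v⁆ - shifted φ V ⁅y, q⁆ v - φ ⁅y, q⁆ • v := by
  have h : ((⁅y, q⁆ : p) : L) = ⁅y, (q : L)⁆ := rfl
  rw [shifted_apply, shifted_apply, shifted_apply, h, leibniz_lie (q : L) y v,
    ← lie_skew y (q : L), neg_lie, lie_sub, lie_smul]
  abel

variable {w} (hw : ∀ q : p, ⁅(q : L), w⁆ = φ q • w)

include hw

lemma shifted_mem_filt {n : ℕ} (q : p) {v : V} (hv : v ∈ filt K x w (n + 1)) :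
    shifted φ V q v ∈ filt K x w n := by
  have h0 (q : p) : shifted φ V q w = 0 := by rw [shifted_apply, hw, sub_self]
  induction n generalizing q v with
  | zero =>
    refine filt_succ_induction x w _ _ (by rw [h0]; exact zero_mem _) (fun j u hu => ?_) hv
    rw [(Submodule.mem_bot K).1 hu, lie_zero, map_zero]
    exact zero_mem _
  | succ n ih =>
    refine filt_succ_induction x w _ _ (by rw [h0]; exact zero_mem _) (fun j u hu => ?_) hv
    rw [shifted_lie]
    exact sub_mem (sub_mem (lie_mem_filt x w j (ih q hu)) (filt_le_succ x w n (ih _ hu)))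
      (Submodule.smul_mem _ _ hu)

lemma ideal_lie_mem_filt {n : ℕ} (q : p) {v : V} (hv : v ∈ filt K x w n) :
    ⁅(q : L), v⁆ ∈ filt K x w n := by
  cases n with
  | zero =>
    rw [(Submodule.mem_bot K).1 hv, lie_zero]
    exact zero_mem _
  | succ n =>
    have h : ⁅(q : L), v⁆ = shifted φ V q v + φ q • v := by rw [shifted_apply, sub_add_cancel]
    rw [h]
    exact add_mem (filt_le_succ x w n (shifted_mem_filt x hw q hv)) (Submodule.smul_mem _ _ hv)

/-- The Euler operator attached to a dual family acts on the associated graded module by minus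
the degree. -/
lemma euler_mem_filt [Fintype ι] [DecidableEq ι] (q : ι → p)
    (hq : ∀ i j, φ ⁅x j, q i⁆ = if i = j then 1 else 0)
    (hx : ∀ i j, ⁅x i, x j⁆ ∈ Submodule.span K (Set.range x)) {n : ℕ} {v : V}
    (hv : v ∈ filt K x w (n + 1)) :
    ∑ i, ⁅x i, shifted φ V (q i) v⁆ + (n : K) • v ∈ filt K x w n := by
  have h0 (q : p) : shifted φ V q w = 0 := by rw [shifted_apply, hw, sub_self]
  let E : Module.End K V := ∑ i, LieModule.toEnd K L V (x i) ∘ₗ shifted φ V (q i)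
  have hE (v : V) : E v = ∑ i, ⁅x i, shifted φ V (q i) v⁆ := by simp [E]
  induction n generalizing v with
  | zero =>
    have hz (q : p) : shifted φ V q v = 0 :=
      (Submodule.mem_bot K).1 (shifted_mem_filt x hw q hv)
    simp [hz]
  | succ n ih =>
    rw [← hE]
    refine filt_succ_induction x w (E + ((n + 1 : ℕ) : K) • (1 : Module.End K V)) _ ?_
      (fun j u hu => ?_) hv
    · simp only [LinearMap.add_apply, hE, h0, lie_zero, Finset.sum_const_zero, zero_add,
        LinearMap.smul_apply, Module.End.one_apply]
      exact Submodule.smul_mem _ _ (mem_filt_succ x w n)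
    · have hu' (q : p) : shifted φ V q u ∈ filt K x w n := shifted_mem_filt x hw q hu
      have h1 : ∑ i, φ ⁅x j, q i⁆ • ⁅x i, u⁆ = ⁅x j, u⁆ := by simp [hq]
      have key : E ⁅x j, u⁆ + ((n + 1 : ℕ) : K) • ⁅x j, u⁆ =
          -- The dual-family sum `∑ φ ⁅x j, q i⁆ • ⁅x i, u⁆ = ⁅x j, u⁆` is what raises the
          -- eigenvalue from `n` to `n + 1`; the last two sums are of lower order.
          ⁅x j, E u + (n : K) • u⁆ + ∑ i, ⁅⁅x i, x j⁆, shifted φ V (q i) u⁆ -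
            ∑ i, ⁅x i, shifted φ V ⁅x j, q i⁆ u⁆ := by
        have h2 : E ⁅x j, u⁆ = ⁅x j, E u⁆ + ∑ i, ⁅⁅x i, x j⁆, shifted φ V (q i) u⁆ -
            ∑ i, ⁅x i, shifted φ V ⁅x j, q i⁆ u⁆ - ∑ i, φ ⁅x j, q i⁆ • ⁅x i, u⁆ := by
          rw [hE, hE, lie_sum, ← Finset.sum_add_distrib, ← Finset.sum_sub_distrib,
            ← Finset.sum_sub_distrib]
          refine Finset.sum_congr rfl fun i _ => ?_
          rw [shifted_lie, lie_sub, lie_sub, lie_smul, leibniz_lie (x i) (x j)]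
          abel
        rw [h2, h1, lie_add, lie_smul, Nat.cast_add, Nat.cast_one, add_smul, one_smul]
        abel
      change E ⁅x j, u⁆ + ((n + 1 : ℕ) : K) • ⁅x j, u⁆ ∈ _
      rw [key]
      have hi := ih hu
      rw [← hE] at hi
      exact sub_mem (add_mem (lie_mem_filt x w j hi)
        (sum_mem fun i _ => lie_mem_filt_of_mem_span x w (hx i j) (hu' _)))
        (sum_mem fun i _ => lie_mem_filt x w i (hu' _))

lemma exists_mem_filt (hgen : ∀ N : Submodule K V, (∀ (y : L), ∀ v ∈ N, ⁅y, v⁆ ∈ N) → w ∈ N → N = ⊤)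
    (hsup : ∀ y : L, ∃ a ∈ Submodule.span K (Set.range x), ∃ u : p, y = a + u) (v : V) :
    ∃ n, v ∈ filt K x w n := by
  have hmono : Monotone (filt K x w) := monotone_nat_of_le_succ (filt_le_succ x w)
  have hmem (v : V) : v ∈ ⨆ n, filt K x w n ↔ ∃ n, v ∈ filt K x w n :=
    Submodule.mem_iSup_of_directed _ hmono.directed_le
  rw [← hmem, hgen (⨆ n, filt K x w n)]
  · trivial
  · intro y v hv
    rw [hmem] at hv ⊢
    obtain ⟨n, hn⟩ := hv
    obtain ⟨a, ha, u, rfl⟩ := hsup y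
    refine ⟨n + 1, ?_⟩
    rw [add_lie]
    exact add_mem (lie_mem_filt_of_mem_span x w ha hn)
      (filt_le_succ x w n (ideal_lie_mem_filt x hw u hn))
  · rw [hmem]
    exact ⟨1, mem_filt_succ x w 0⟩

/-- A cyclic module generated by a vector of character `φ` is irreducible if `φ` separates the
family `x`, which spans a complement of `p`. -/
theorem isIrreducible_of_dual_family [CharZero K] [Fintype ι] [DecidableEq ι] (hw0 : w ≠ 0)
    (q : ι → p) (hq : ∀ i j, φ ⁅x j, q i⁆ = if i = j then 1 else 0)
    (hx : ∀ i j, ⁅x i, x j⁆ ∈ Submodule.span K (Set.range x))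
    (hgen : ∀ N : Submodule K V, (∀ (y : L), ∀ v ∈ N, ⁅y, v⁆ ∈ N) → w ∈ N → N = ⊤)
    (hsup : ∀ y : L, ∃ a ∈ Submodule.span K (Set.range x), ∃ u : p, y = a + u) :
    LieModule.IsIrreducible K L V := by
  have : Nontrivial V := ⟨w, 0, hw0⟩
  refine LieModule.IsIrreducible.mk fun N hN => ?_
  obtain ⟨v₀, hv₀, hv₀'⟩ := (Submodule.ne_bot_iff N.toSubmodule).1
    fun h => hN ((LieSubmodule.toSubmodule_eq_bot N).1 h)
  classical
  have hex : ∃ n, ∃ v ∈ N, v ≠ 0 ∧ v ∈ filt K x w n := by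
    obtain ⟨n, hn⟩ := exists_mem_filt x hw hgen hsup v₀
    exact ⟨n, v₀, hv₀, hv₀', hn⟩
  obtain ⟨v, hvN, hv0, hv⟩ := Nat.find_spec hex
  have hmin : ∀ m < Nat.find hex, ∀ v ∈ N, v ∈ filt K x w m → v = 0 := fun m hm v hvN hv => by
    by_contra h
    exact Nat.find_min hex hm ⟨v, hvN, h, hv⟩
  generalize Nat.find hex = n at hv hmin
  cases n with
  | zero => exact absurd ((Submodule.mem_bot K).1 hv) hv0
  | succ m =>
    -- `q i - φ (q i)` preserves `N` and lowers the filtration, so minimality makes the image zero.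
    have hs (i : ι) : shifted φ V (q i) v = 0 :=
      hmin m (Nat.lt_succ_self m) _
        (N.sub_mem (N.lie_mem hvN) (N.smul_mem _ hvN)) (shifted_mem_filt x hw (q i) hv)
    have hE := euler_mem_filt x hw q hq hx hv
    simp only [hs, lie_zero, Finset.sum_const_zero, zero_add] at hE
    cases m with
    -- In degree 0 the Euler relation is empty, but `v` is then a scalar multiple of `w`.
    | zero =>
      have hv' : v ∈ Submodule.span K {w} := by
        refine filt_succ_induction x w LinearMap.id _ (Submodule.mem_span_singleton_self w)
          (fun j u hu => ?_) hv
        rw [(Submodule.mem_bot K).1 hu, lie_zero, map_zero]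
        exact zero_mem _
      obtain ⟨c, rfl⟩ := Submodule.mem_span_singleton.1 hv'
      have hc : c ≠ 0 := fun h => hv0 (by rw [h, zero_smul])
      have hwN : w ∈ N := by
        have := N.smul_mem c⁻¹ hvN
        rwa [smul_smul, inv_mul_cancel₀ hc, one_smul] at this
      have := hgen N.toSubmodule (fun y u hu => N.lie_mem hu) hwN
      exact (LieSubmodule.toSubmodule_eq_top N).1 this
    | succ m =>
      have hm : ((m + 1 : ℕ) : K) ≠ 0 := Nat.cast_ne_zero.2 (Nat.succ_ne_zero m)
      exact absurd (hmin (m + 1) (Nat.lt_succ_self _) v hvN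
        ((Submodule.smul_mem_iff _ hm).1 hE)) hv0

end Filtration

/-! ### The bracket matrix and the two implications. -/

variable {K L : Type*} [Field K] [LieRing L] [LieAlgebra K L] {g₀ : LieSubalgebra K L}
  {p : LieIdeal K L} (φ : LieAlgebra.LieCharacter K p)

/-- The linear map `x ↦ φ ∘ ad x` from the subalgebra to the dual of the ideal. -/
def bracketForm (g₀ : LieSubalgebra K L) : g₀ →ₗ[K] p →ₗ[K] K :=
  LinearMap.mk₂ K (fun x q => φ ⁅(x : L), q⁆) (by simp) (by simp) (by simp) (by simp)

lemma bracketForm_apply (x : g₀) (q : p) : bracketForm φ g₀ x q = φ ⁅(x : L), q⁆ := rfl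

lemma bracketMatrix_mulVec {m n : Type*} [Fintype n] (b : Basis n K g₀) (c : Basis m K p)
    (y : n → K) (k : m) :
    (bracketMatrix φ b c).mulVec y k = bracketForm φ g₀ (b.equivFun.symm y) (c k) := by
  rw [Basis.equivFun_symm_apply, map_sum, LinearMap.sum_apply, Matrix.mulVec, dotProduct]
  refine Finset.sum_congr rfl fun j _ => ?_
  rw [map_smul, LinearMap.smul_apply, smul_eq_mul, mul_comm]
  rfl

lemma rank_bracketMatrix_eq_iff {m n : Type*} [Fintype n] [Fintype m] (b : Basis n K g₀)
    (c : Basis m K p) :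
    (bracketMatrix φ b c).rank = Fintype.card n ↔ Function.Injective (bracketForm φ g₀) := by
  have h1 : (bracketMatrix φ b c).rank = Fintype.card n ↔
      LinearMap.ker (bracketMatrix φ b c).mulVecLin = ⊥ := by
    have := LinearMap.finrank_range_add_finrank_ker (bracketMatrix φ b c).mulVecLin
    rw [Module.finrank_fintype_fun_eq_card] at this
    rw [← Submodule.finrank_eq_zero, Matrix.rank]
    omega
  have h2 (y : n → K) : (bracketMatrix φ b c).mulVecLin y = 0 ↔
      bracketForm φ g₀ (b.equivFun.symm y) = 0 := by
    rw [funext_iff, Matrix.mulVecLin_apply]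
    simp only [bracketMatrix_mulVec]
    exact ⟨fun h => c.ext h, fun h k => by rw [h]; rfl⟩
  rw [h1, LinearMap.ker_eq_bot', injective_iff_map_eq_zero]
  constructor
  · intro h x hx
    have := h (b.equivFun x) ((h2 _).2 (by rwa [LinearEquiv.symm_apply_apply]))
    simpa using this
  · intro h y hy
    exact b.equivFun.symm.map_eq_zero_iff.1 (h _ ((h2 y).1 hy))

lemma exists_dual_family {m n : Type*} [Fintype n] [Fintype m] [DecidableEq n] (b : Basis n K g₀)
    (c : Basis m K p) (h : Function.Injective (bracketForm φ g₀)) :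
    ∃ q : n → p, ∀ i j, φ ⁅(b j : L), q i⁆ = if i = j then 1 else 0 := by
  classical
  have hinj : LinearMap.ker
      ((c.constr K).symm.toLinearMap ∘ₗ bracketForm φ g₀ : g₀ →ₗ[K] m → K) = ⊥ :=
    LinearMap.ker_eq_bot.2 ((c.constr K).symm.injective.comp h)
  obtain ⟨G, hG⟩ := LinearMap.exists_leftInverse_of_injective _ hinj
  -- The `i`-th coordinate of the left inverse `G` is a functional on `m → K`; its coefficients on
  -- the standard basis give `q i`.
  refine ⟨fun i => ∑ k, b.repr (G (Pi.single k 1)) i • c k, fun i j => ?_⟩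
  have h1 : G (fun k => bracketForm φ g₀ (b j) (c k)) = b j := LinearMap.congr_fun hG (b j)
  rw [← bracketForm_apply, map_sum]
  have h2 : (fun k => bracketForm φ g₀ (b j) (c k)) =
      ∑ k, bracketForm φ g₀ (b j) (c k) • (Pi.single k (1 : K) : m → K) := by
    funext k
    simp [Finset.sum_apply, Pi.single_apply]
  rw [h2, map_sum] at h1
  have h3 := congrArg (fun z => b.repr z i) h1
  simp only [map_sum, map_smul, Finsupp.coe_finsetSum, Finset.sum_apply, Finsupp.smul_apply,
    Basis.repr_self, Finsupp.single_apply] at h3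
  simp only [map_smul, smul_eq_mul] at h3 ⊢
  simp only [eq_comm (a := i)]
  rw [← h3]
  exact Finset.sum_congr rfl fun k _ => mul_comm _ _

variable {φ}

lemma cyclicVector_ne_zero (h : IsCompl g₀.toSubmodule p.toSubmodule) : cyclicVector φ ≠ 0 := by
  obtain ⟨T, hT, -⟩ := exists_hom_delta h φ (0 : g₀ →ₗ⁅K⁆ Module.End K K) (1 : K)
  intro h0
  rw [h0, map_zero] at hT
  have := delta_one h φ (1 : K)
  rw [← hT] at this
  exact one_ne_zero this.symm

/-- Map to functionals valued in the symmetric algebra of `g₀`: the image of `x w` takes the value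
`x · 1` at the constant polynomial 1. -/
lemma lie_cyclicVector_ne_zero (h : IsCompl g₀.toSubmodule p.toSubmodule) {x : g₀} (hx0 : x ≠ 0)
    (hx : ∀ q : p, φ ⁅(x : L), q⁆ = 0) : ⁅(x : L), cyclicVector φ⁆ ≠ 0 := by
  obtain ⟨_, _⟩ := exists_wellFoundedLT (Basis.ofVectorSpaceIndex K g₀)
  let e := Basis.ofVectorSpace K g₀
  obtain ⟨T, hT, hT'⟩ := exists_hom_delta h φ (PoincareBirkhoffWitt.rep e)
    (PoincareBirkhoffWitt.mon K 0)
  intro h0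
  have h1 := hT' x (cyclicVector φ)
  rw [h0, map_zero, hT, dualRep_delta_sub h φ _ _ x hx] at h1
  have h2 := delta_one h φ (PoincareBirkhoffWitt.rep e x (PoincareBirkhoffWitt.mon K 0))
  rw [← h1] at h2
  exact hx0 (PoincareBirkhoffWitt.rep_injective e h2.symm)

/-- A nonzero `x` in the kernel gives a proper nonzero submodule: the kernel of the map to scalar
functionals contains `x w ≠ 0` but not `w`. -/
theorem bracketForm_injective_of_isIrreducible (h : IsCompl g₀.toSubmodule p.toSubmodule)
    [LieModule.IsIrreducible K L (W φ)] : Function.Injective (bracketForm φ g₀) := by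
  refine (injective_iff_map_eq_zero _).2 fun x hx => ?_
  by_contra hx0
  replace hx (q : p) : φ ⁅(x : L), q⁆ = 0 := LinearMap.congr_fun hx q
  obtain ⟨T, hT, hT'⟩ := exists_hom_delta h φ (0 : g₀ →ₗ⁅K⁆ Module.End K K) (1 : K)
  let N : LieSubmodule K L (W φ) :=
    { LinearMap.ker T with
      lie_mem := fun {y u} hu => by
        change T ⁅y, u⁆ = 0
        rw [hT', show T u = 0 from hu, map_zero] }
  have hmem : ⁅(x : L), cyclicVector φ⁆ ∈ N := by
    change T ⁅(x : L), cyclicVector φ⁆ = 0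
    rw [hT', hT, dualRep_delta_sub h φ _ _ x hx]
    refine LinearMap.ext fun f => ?_
    simp [delta_apply]
  have hN : N ≠ ⊥ := fun hN => lie_cyclicVector_ne_zero h hx0 hx
    ((LieSubmodule.mem_bot _).1 (hN ▸ hmem))
  have htop : N = ⊤ := (eq_bot_or_eq_top N).resolve_left hN
  have hw : T (cyclicVector φ) = 0 := by
    have : cyclicVector φ ∈ N := htop ▸ LieSubmodule.mem_top _
    exact this
  have h1 := delta_one h φ (1 : K)
  rw [← hT, hw] at h1
  exact one_ne_zero h1.symm

theorem isIrreducible_of_bracketForm_injective [CharZero K]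
    (h : IsCompl g₀.toSubmodule p.toSubmodule) {m n : Type*} [Fintype n] [Fintype m]
    (b : Basis n K g₀) (c : Basis m K p) (hφ : Function.Injective (bracketForm φ g₀)) :
    LieModule.IsIrreducible K L (W φ) := by
  classical
  obtain ⟨q, hq⟩ := exists_dual_family φ b c hφ
  have hspan (a : g₀) : (a : L) ∈ Submodule.span K (Set.range fun j => (b j : L)) := by
    have h1 : Set.range (fun j => (b j : L)) = g₀.toSubmodule.subtype '' Set.range b := by
      rw [← Set.range_comp]
      rfl
    have h2 : Submodule.span K (Set.range b) = ⊤ := b.span_eq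
    rw [h1, ← Submodule.map_span]
    exact ⟨a, h2 ▸ Submodule.mem_top, rfl⟩
  exact isIrreducible_of_dual_family (fun j => (b j : L)) (lie_cyclicVector φ)
    (cyclicVector_ne_zero h) q hq (fun i j => hspan ⁅b i, b j⁆)
    (eq_top_of_cyclicVector_mem φ)
    fun y => ⟨_, hspan (projSub h y), projIdeal h y, (projSub_add_projIdeal h y).symm⟩

end QuasiWhittaker

end

theorem corollary3p6 {g : Type*} [LieRing g] [LieAlgebra ℂ g]
    (g₀ : LieSubalgebra ℂ g) (p : LieIdeal ℂ g)
    (hsemidirect : IsCompl g₀.toSubmodule p.toSubmodule)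
    {t l : ℕ} (b : Module.Basis (Fin t) ℂ g₀) (c : Module.Basis (Fin l) ℂ p)
    (φ : LieAlgebra.LieCharacter ℂ p) :
    LieModule.IsIrreducible ℂ g (QuasiWhittaker.W φ) ↔
      (QuasiWhittaker.bracketMatrix φ b c).rank = t := by
  have h := QuasiWhittaker.rank_bracketMatrix_eq_iff φ b c
  rw [Fintype.card_fin] at h
  rw [h]
  exact ⟨fun _ => QuasiWhittaker.bracketForm_injective_of_isIrreducible hsemidirect,
    QuasiWhittaker.isIrreducible_of_bracketForm_injective hsemidirect b c⟩
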